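/- Let $B_4=\langle\sigma_1,\sigma_2,\sigma_3\mid \sigma_1\sigma_2\sigma_1=\sigma_2\sigma_1\sigma_2,\ \sigma_2\sigma_3\sigma_2=\sigma_3\sigma_2\sigma_3,\ \sigma_1\sigma_3=\sigma_3\sigma_1\rangle$ be the 4-strand braid group, let $B_4^+\subset B_4$ be the submonoid generated by $\sigma_1,\sigma_2,\sigma_3$, and let $\preccurlyeq$ be the prefix (lattice) order on $B_4$: $x\preccurlyeq y$ if and only if $x^{-1}y\in B_4^+$. Put $\Delta=(\sigma_1\sigma_2\sigma_3)(\sigma_1\sigma_2)\sigma_1$. An element $s\in B_4^+$ is simple if $s\preccurlyeq\Delta$, and an ordered pair $(s,s')$ of simple elements is left-weighted if $s$ is the greatest common divisor of $\Delta$ and $ss'$ with respect to $\preccurlyeq$. The classical (Garside, Elrifai–Morton) left normal form of $x\in B_4$ is the unique decomposition $x=\Delta^p s_1\cdots s_r$ with $p\in\mathbb Z$, $r\ge 0$, all $s_i$ simple, $s_1\ne\Delta$ and $s_r\ne 1$ (if $r\ge 1$), and $(s_i,s_{i+1})$ left-weighted for $1\le i<r$. Let $\rho_4:B_4\to \mathrm{GL}(3,\mathbb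 Z[q^{\pm1}])$ be the reduced Burau representation, i.e. the homomorphism with $$\rho_4(\sigma_1)=\begin{pmatrix}-q&0&0\\1&1&0\\0&0&1\end{pmatrix},\quad \rho_4(\sigma_2)=\begin{pmatrix}1&q&0\\0&-q&0\\0&1&1\end{pmatrix},\quad \rho_4(\sigma_3)=\begin{pmatrix}1&0&0\\0&1&q\\0&0&-q\end{pmatrix}.$$ **Theorem.** Let $x\in B_4$ with $x\neq 1$, and let $\Delta^p s_1\cdots s_r$ be its classical left normal form. If $s_i\neq\sigma_2\sigma_1\sigma_3$ for every $i=1,\dots,r$, then $\rho_4(x)\neq 1$. -/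

import Mathlib

open scoped LaurentPolynomial

namespace FourBraid

/-- The defining relators of the group of braids on four strands, in the Artin generators
`σ₁, σ₂, σ₃` (indexed by `0, 1, 2`): the two braid relations and the commutation relation. -/
def artinRelators : Set (FreeGroup (Fin 3)) :=
  { .of 0 * .of 1 * .of 0 * (.of 1 * .of 0 * .of 1)⁻¹,
    .of 1 * .of 2 * .of 1 * (.of 2 * .of 1 * .of 2)⁻¹,
    .of 0 * .of 2 * (.of 2 * .of 0)⁻¹ }

/-- The braid group on four strands, by Artin's presentation. -/
abbrev BraidGroup : Type := PresentedGroup artinRelators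

/-- The first Artin generator. -/
def σ₁ : BraidGroup := PresentedGroup.of 0

/-- The second Artin generator. -/
def σ₂ : BraidGroup := PresentedGroup.of 1

/-- The third Artin generator. -/
def σ₃ : BraidGroup := PresentedGroup.of 2

/-- The monoid of positive braids: products of Artin generators. -/
def positiveMonoid : Submonoid BraidGroup := Submonoid.closure {σ₁, σ₂, σ₃}

/-- The prefix order: `x ≼ y` if and only if `x⁻¹ y` is a positive braid. -/
def Prefix (x y : BraidGroup) : Prop := x⁻¹ * y ∈ positiveMonoid

/-- The half twist `Δ = (σ₁ σ₂ σ₃)(σ₁ σ₂)(σ₁)`. -/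
def Δ : BraidGroup := (σ₁ * σ₂ * σ₃) * (σ₁ * σ₂) * σ₁

/-- Simple elements: the positive prefixes of `Δ`. -/
def IsSimple (s : BraidGroup) : Prop := s ∈ positiveMonoid ∧ Prefix s Δ

/-- `d` is the greatest common divisor of `x` and `y` for the prefix order. -/
def IsPrefixGcd (x y d : BraidGroup) : Prop :=
  Prefix d x ∧ Prefix d y ∧ ∀ t : BraidGroup, Prefix t x → Prefix t y → Prefix t d

/-- The ordered pair `(s, s')` is left-weighted: `Δ ∧ (s s') = s`. -/
def LeftWeighted (s s' : BraidGroup) : Prop := IsPrefixGcd Δ (s * s') s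

/-- `Δ ^ p * s₁ * ⋯ * sᵣ`, with `[s₁, …, sᵣ] = L`, is the classical (Garside, Elrifai–Morton)
left normal form of `x`: all factors are simple, the first is not `Δ`, the last is not `1`,
and consecutive factors are left-weighted. The list may be empty (`r = 0`). -/
structure IsLeftNormalForm (x : BraidGroup) (p : ℤ) (L : List BraidGroup) : Prop where
  eq_prod : x = Δ ^ p * L.prod
  simple : ∀ s ∈ L, IsSimple s
  head_ne : L.head? ≠ some Δ
  last_ne : L.getLast? ≠ some 1
  weighted : L.IsChain LeftWeighted

/-- The variable `q` of the Laurent polynomial ring `ℤ[q, q⁻¹]`. -/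
noncomputable def q : ℤ[T;T⁻¹] := LaurentPolynomial.T 1

/-- The inverse of the variable `q`. -/
noncomputable def qInv : ℤ[T;T⁻¹] := LaurentPolynomial.T (-1)

theorem q_mul_qInv : q * qInv = 1 := by
  rw [q, qInv, ← LaurentPolynomial.T_add]; simp

theorem qInv_mul_q : qInv * q = 1 := by
  rw [mul_comm, q_mul_qInv]

/-- The reduced Burau matrix of `σ₁`, with its inverse. -/
noncomputable def burau₁ : GL (Fin 3) ℤ[T;T⁻¹] where
  val := !![-q, 0, 0; 1, 1, 0; 0, 0, 1]
  inv := !![-qInv, 0, 0; qInv, 1, 0; 0, 0, 1]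
  val_inv := by
    simp [Matrix.one_fin_three, q_mul_qInv]
  inv_val := by
    simp [Matrix.one_fin_three, qInv_mul_q]

/-- The reduced Burau matrix of `σ₂`, with its inverse. -/
noncomputable def burau₂ : GL (Fin 3) ℤ[T;T⁻¹] where
  val := !![1, q, 0; 0, -q, 0; 0, 1, 1]
  inv := !![1, 1, 0; 0, -qInv, 0; 0, qInv, 1]
  val_inv := by
    simp [Matrix.one_fin_three, q_mul_qInv]
  inv_val := by
    simp [Matrix.one_fin_three, qInv_mul_q]

/-- The reduced Burau matrix of `σ₃`, with its inverse. -/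
noncomputable def burau₃ : GL (Fin 3) ℤ[T;T⁻¹] where
  val := !![1, 0, 0; 0, 1, q; 0, 0, -q]
  inv := !![1, 0, 0; 0, 1, 1; 0, 0, -qInv]
  val_inv := by
    simp [Matrix.one_fin_three, q_mul_qInv]
  inv_val := by
    simp [Matrix.one_fin_three, qInv_mul_q]

theorem burau_rel₁₂ : burau₁ * burau₂ * burau₁ = burau₂ * burau₁ * burau₂ := by
  apply Units.ext
  simp [burau₁, burau₂]

theorem burau_rel₂₃ : burau₂ * burau₃ * burau₂ = burau₃ * burau₂ * burau₃ := by
  apply Units.ext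
  simp [burau₂, burau₃]

theorem burau_rel₁₃ : burau₁ * burau₃ = burau₃ * burau₁ := by
  apply Units.ext
  simp [burau₁, burau₃]

theorem burau_relators (r : FreeGroup (Fin 3)) (hr : r ∈ artinRelators) :
    FreeGroup.lift ![burau₁, burau₂, burau₃] r = 1 := by
  rcases hr with rfl | rfl | rfl
  · rw [map_mul, map_inv, mul_inv_eq_one]
    simpa using burau_rel₁₂
  · rw [map_mul, map_inv, mul_inv_eq_one]
    simpa using burau_rel₂₃
  · rw [map_mul, map_inv, mul_inv_eq_one]
    simpa using burau_rel₁₃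

/-- The reduced Burau representation `ρ₄`, sending `σᵢ` to its Burau matrix. -/
noncomputable def ρ₄ : BraidGroup →* GL (Fin 3) ℤ[T;T⁻¹] :=
  PresentedGroup.toGroup burau_relators

end FourBraid

open scoped LaurentPolynomial

namespace FourBraid

/-! ### Positive words -/

/-! Substitute `q = y⁻²` and conjugate by a diagonal matrix: each generator then becomes `y⁻²` times
a polynomial matrix in `y`. The lowest-order coefficient is the leading matrix, and its nonzero rows
are the peak rows, an invariant of the Burau matrix.

The 24 simple braids are `1`, `Δ`, `σ₂σ₁σ₃`, `σ₁σ₃σ₂`, ten thin ones with leading matrix `-E i j`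
(first letter `i`, last letter `j`), and their ten complements. For a complement `s`, the inverse
`s⁻¹ = (s⁻¹Δ)Δ⁻¹` has a matrix unit as leading matrix.

Left-weightedness makes these units compose without cancellation. After a thin factor ending in `j`,
the next factor can begin only with `j`, so it is again thin once `σ₂σ₁σ₃` is excluded. That braid
is the obstruction: it has one first letter but two last letters, so its successor may begin with
both `σ₁` and `σ₃`. Hence a product starting with a thin factor has a single peak row, its first
letter (`IsThin.hasPeak_prod`), and one starting with `σ₁σ₃σ₂` has peak rows `{0, 2}`.

If `ρ₄ x = 1`, then `s₁⋯sᵣ` and `Δ⁻ᵖ` have the same image. Leading cothin factors are carried to the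
`Δ⁻ᵖ` side, which then has a single peak row `j`, while the next factor cannot begin with `j`. The
first factor that is not cothin, or the empty product, gives different peak rows (`ρ₄_prod_ne`).
Pure powers of `Δ` are detected by the order of their leading term. -/

/-- The positive braid spelled by a word in the Artin generators. -/
def braid (w : List (Fin 3)) : BraidGroup := (w.map PresentedGroup.of).prod

@[simp] theorem braid_nil : braid [] = 1 := rfl

theorem braid_cons (i : Fin 3) (w : List (Fin 3)) :
    braid (i :: w) = PresentedGroup.of i * braid w := by simp [braid]

theorem braid_append (v w : List (Fin 3)) : braid (v ++ w) = braid v * braid w := by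
  simp [braid]

theorem braid_singleton (i : Fin 3) : braid [i] = PresentedGroup.of i := by simp [braid]

theorem of_mem_positiveMonoid (i : Fin 3) :
    (PresentedGroup.of i : BraidGroup) ∈ positiveMonoid := by
  apply Submonoid.subset_closure
  fin_cases i <;> simp [σ₁, σ₂, σ₃]

theorem braid_mem_positiveMonoid (w : List (Fin 3)) : braid w ∈ positiveMonoid := by
  refine Submonoid.list_prod_mem _ fun x hx => ?_
  obtain ⟨i, -, rfl⟩ := List.mem_map.1 hx
  exact of_mem_positiveMonoid i

theorem exists_braid_eq {x : BraidGroup} (hx : x ∈ positiveMonoid) : ∃ w, braid w = x := by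
  induction hx using Submonoid.closure_induction with
  | mem x hx =>
    rcases hx with rfl | rfl | rfl
    exacts [⟨[0], braid_singleton 0⟩, ⟨[1], braid_singleton 1⟩, ⟨[2], braid_singleton 2⟩]
  | one => exact ⟨[], rfl⟩
  | mul x y _ _ ihx ihy =>
    obtain ⟨v, rfl⟩ := ihx
    obtain ⟨w, rfl⟩ := ihy
    exact ⟨v ++ w, braid_append v w⟩

/-- A word for the half twist. -/
def halfTwist : List (Fin 3) := [0, 1, 2, 0, 1, 0]

theorem braid_halfTwist : braid halfTwist = Δ := by
  simp [braid, halfTwist, Δ, σ₁, σ₂, σ₃, mul_assoc]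

theorem braid_rel₁₂ : braid [1, 0, 1] = braid [0, 1, 0] := by
  have h := PresentedGroup.one_of_mem (rels := artinRelators) (Or.inl rfl)
  rw [map_mul, map_inv, mul_inv_eq_one] at h
  simpa [braid, PresentedGroup.of, mul_assoc] using h.symm

theorem braid_rel₂₃ : braid [2, 1, 2] = braid [1, 2, 1] := by
  have h := PresentedGroup.one_of_mem (rels := artinRelators) (Or.inr (Or.inl rfl))
  rw [map_mul, map_inv, mul_inv_eq_one] at h
  simpa [braid, PresentedGroup.of, mul_assoc] using h.symm

theorem braid_rel₁₃ : braid [2, 0] = braid [0, 2] := by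
  have h := PresentedGroup.one_of_mem (rels := artinRelators) (Or.inr (Or.inr rfl))
  rw [map_mul, map_inv, mul_inv_eq_one] at h
  simpa [braid, PresentedGroup.of, mul_assoc] using h.symm

/-- Resolves the overlap of the rules for `2 1 2` and `2 0` in the word `2 1 2 0`. -/
theorem braid_rel₃₂₁₃ : braid [2, 1, 0, 2] = braid [1, 2, 1, 0] := by
  rw [show ([2, 1, 0, 2] : List (Fin 3)) = [2, 1] ++ [0, 2] from rfl, braid_append, ← braid_rel₁₃,
    ← braid_append, show ([2, 1] ++ [2, 0] : List (Fin 3)) = [2, 1, 2] ++ [0] from rfl,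
    braid_append, braid_rel₂₃, ← braid_append]
  rfl

/-- One pass of rewriting by the braid relations, towards lexicographically smaller words. -/
def rewrite : List (Fin 3) → List (Fin 3)
  | 2 :: 0 :: w => 0 :: 2 :: w
  | 1 :: 0 :: 1 :: w => 0 :: 1 :: 0 :: w
  | 2 :: 1 :: 2 :: w => 1 :: 2 :: 1 :: w
  | 2 :: 1 :: 0 :: 2 :: w => 1 :: 2 :: 1 :: 0 :: w
  | i :: w => i :: rewrite w
  | [] => []

theorem braid_rewrite (w : List (Fin 3)) : braid (rewrite w) = braid w := by
  fun_induction rewrite w with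
  | case1 w => simpa [braid, mul_assoc] using congrArg (· * braid w) braid_rel₁₃.symm
  | case2 w => simpa [braid, mul_assoc] using congrArg (· * braid w) braid_rel₁₂.symm
  | case3 w => simpa [braid, mul_assoc] using congrArg (· * braid w) braid_rel₂₃.symm
  | case4 w => simpa [braid, mul_assoc] using congrArg (· * braid w) braid_rel₃₂₁₃.symm
  | case5 i w _ _ _ _ ih => rw [braid_cons, braid_cons, ih]
  | case6 => rfl

/-- Ten passes of rewriting; this solves the word problem for divisors of the half twist. -/
def reduce (w : List (Fin 3)) : List (Fin 3) := rewrite^[10] w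

theorem braid_reduce (w : List (Fin 3)) : braid (reduce w) = braid w := by
  have h (n : ℕ) : braid (rewrite^[n] w) = braid w := by
    induction n with
    | zero => rfl
    | succ n ih => rw [Function.iterate_succ_apply', braid_rewrite, ih]
  exact h 10

theorem braid_eq_of_reduce_eq {v w : List (Fin 3)} (h : reduce v = reduce w) :
    braid v = braid w := by
  rw [← braid_reduce v, h, braid_reduce]

/-! ### Length and permutation of a braid -/

/-- The exponent sum. -/
def exponentSum : BraidGroup →* Multiplicative ℤ :=
  PresentedGroup.toGroup (f := fun _ => Multiplicative.ofAdd 1) <| by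
    rintro r (rfl | rfl | rfl) <;> simp

theorem exponentSum_braid (w : List (Fin 3)) :
    exponentSum (braid w) = Multiplicative.ofAdd (w.length : ℤ) := by
  induction w with
  | nil => rfl
  | cons i w ih =>
    rw [braid_cons, map_mul, ih, exponentSum, PresentedGroup.toGroup.of, ← ofAdd_add]
    simp [add_comm]

theorem inv_of_notMem_positiveMonoid (i : Fin 3) :
    (PresentedGroup.of i : BraidGroup)⁻¹ ∉ positiveMonoid := by
  intro h
  obtain ⟨w, hw⟩ := exists_braid_eq h
  have h1 := congrArg exponentSum hw
  rw [map_inv, ← braid_singleton, exponentSum_braid, exponentSum_braid, ← ofAdd_neg] at h1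
  have := Multiplicative.ofAdd.injective h1
  simp at this

/-- The permutation of the strands induced by an Artin generator. -/
def transposition (i : Fin 3) : Equiv.Perm (Fin 4) := Equiv.swap i.castSucc i.succ

/-- The permutation of the strands induced by a braid. -/
def strandPerm : BraidGroup →* Equiv.Perm (Fin 4) :=
  PresentedGroup.toGroup (f := transposition) <| by
    rintro r (rfl | rfl | rfl) <;>
      simp only [map_mul, map_inv, FreeGroup.lift_apply_of] <;> decide

/-- The number of inversions of a permutation of the strands. -/
def inversions (g : Equiv.Perm (Fin 4)) : ℕ :=
  (Finset.univ.filter fun p : Fin 4 × Fin 4 => p.1 < p.2 ∧ g p.2 < g p.1).card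

/-- Exchanging two adjacent values changes the relative order of one pair only; checked by
enumeration. -/
theorem inversions_transposition_mul (i : Fin 3) (g : Equiv.Perm (Fin 4)) :
    inversions (transposition i * g) ≤ inversions g + 1 := by
  revert i g
  decide +kernel

/-- The permutation of the strands spelled by a word. -/
def wordPerm (w : List (Fin 3)) : Equiv.Perm (Fin 4) := (w.map transposition).prod

theorem strandPerm_braid (w : List (Fin 3)) : strandPerm (braid w) = wordPerm w := by
  induction w with
  | nil => rfl
  | cons i w ih =>
    rw [braid_cons, map_mul, ih, strandPerm, PresentedGroup.toGroup.of]
    simp [wordPerm]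

theorem inversions_wordPerm_le (w : List (Fin 3)) : inversions (wordPerm w) ≤ w.length := by
  induction w with
  | nil => decide
  | cons i w ih =>
    have := inversions_transposition_mul i (wordPerm w)
    simp only [wordPerm, List.map_cons, List.prod_cons, List.length_cons] at *
    omega

/-! ### The divisors of the half twist -/

/-- Reduced words for the 24 divisors of the half twist. -/
def simpleWords : List (List (Fin 3)) := do
  let a ← [[], [0]]
  let b ← [[], [1], [1, 0]]
  let c ← [[], [2], [2, 1], [2, 1, 0]]
  return reduce (a ++ b ++ c)

/-- When a letter leads out of the list, the permutation still missing from the half twist has too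
many inversions for the letters left out of six. -/
theorem reduce_append_mem_or (v : List (Fin 3)) (hv : v ∈ simpleWords) (i : Fin 3) :
    reduce (v ++ [i]) ∈ simpleWords ∨
      6 < inversions ((wordPerm (v ++ [i]))⁻¹ * wordPerm halfTwist) + (v.length + 1) := by
  revert i v
  decide +kernel

theorem exists_mem_simpleWords (w u : List (Fin 3)) (h : braid (w ++ u) = Δ) :
    ∃ v ∈ simpleWords, v.length = w.length ∧ braid w = braid v := by
  induction w using List.reverseRecOn generalizing u with
  | nil => exact ⟨[], by decide, rfl, rfl⟩
  | append_singleton w i ih =>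
    obtain ⟨v, hv, hl, hwv⟩ := ih (i :: u) (by rw [← h]; simp)
    have e : braid (w ++ [i]) = braid (v ++ [i]) := by
      rw [braid_append, hwv, braid_append]
    rcases reduce_append_mem_or v hv i with hr | hr
    · refine ⟨_, hr, ?_, by rw [braid_reduce, e]⟩
      have := congrArg exponentSum (braid_reduce (v ++ [i]))
      rw [exponentSum_braid, exponentSum_braid] at this
      have := Multiplicative.ofAdd.injective this
      simp at this
      simp
      omega
    · exfalso
      rw [braid_append, e, ← braid_append, ← braid_halfTwist] at h
      have h1 := congrArg exponentSum h
      rw [exponentSum_braid, exponentSum_braid] at h1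
      have h1 := Multiplicative.ofAdd.injective h1
      have h2 := congrArg strandPerm h
      rw [strandPerm_braid, strandPerm_braid, wordPerm, List.map_append, List.prod_append,
        ← wordPerm, ← wordPerm, ← eq_inv_mul_iff_mul_eq] at h2
      have h3 := inversions_wordPerm_le u
      rw [h2] at h3
      simp [halfTwist] at h1
      omega

theorem IsSimple.exists_mem_simpleWords {s : BraidGroup} (hs : IsSimple s) :
    ∃ v ∈ simpleWords, s = braid v := by
  obtain ⟨w, rfl⟩ := exists_braid_eq hs.1
  obtain ⟨u, hu⟩ := exists_braid_eq hs.2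
  obtain ⟨v, hv, -, h⟩ := FourBraid.exists_mem_simpleWords w u (by rw [braid_append, hu]; group)
  exact ⟨v, hv, h⟩

theorem prefix_of_reduce_eq {v u : List (Fin 3)} {k : Fin 3} (h : reduce v = reduce (k :: u)) :
    Prefix (.of k) (braid v) := by
  rw [braid_eq_of_reduce_eq h, Prefix, braid_cons, inv_mul_cancel_left]
  exact braid_mem_positiveMonoid u

theorem mul_prefix_of_reduce_eq {v u : List (Fin 3)} {k : Fin 3}
    (h : reduce (v ++ k :: u) = reduce halfTwist) : Prefix (braid v * .of k) Δ := by
  have := braid_eq_of_reduce_eq h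
  rw [braid_append, braid_cons, braid_halfTwist, ← mul_assoc] at this
  rw [Prefix, ← this, inv_mul_cancel_left]
  exact braid_mem_positiveMonoid u

/-- Words for the simple braids having exactly one first letter `i` and exactly one last
letter `j`, listed with `i` and `j`. -/
def thinWords : List (List (Fin 3) × Fin 3 × Fin 3) :=
  [([0], 0, 0), ([0, 1], 0, 1), ([0, 1, 2], 0, 2), ([1, 0], 1, 0), ([1], 1, 1),
    ([1, 0, 2, 1], 1, 1), ([1, 2], 1, 2), ([2, 1, 0], 2, 0), ([2, 1], 2, 1), ([2], 2, 2)]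

/-- A braid with single first letter `i` and single last letter `j` (so not `1` or `Δ`). -/
structure IsThin (i j : Fin 3) (s : BraidGroup) : Prop where
  mem : ∃ w, (w, i, j) ∈ thinWords ∧ s = braid w
  prefix_first : Prefix (.of i) s
  mul_prefix : ∀ k ≠ j, Prefix (s * .of k) Δ

theorem thinWords_head : ∀ e ∈ thinWords, e.1.head? = some e.2.1 := by decide

theorem thinWords_mul : ∀ e ∈ thinWords, ∀ k ≠ e.2.2,
    ∃ u ∈ simpleWords, reduce (e.1 ++ k :: u) = reduce halfTwist := by
  decide +kernel

theorem isThin_braid {w : List (Fin 3)} {i j : Fin 3} (h : (w, i, j) ∈ thinWords) :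
    IsThin i j (braid w) where
  mem := ⟨w, h, rfl⟩
  prefix_first := by
    obtain ⟨u, hu⟩ := List.head?_eq_some_iff.1 (thinWords_head _ h)
    exact prefix_of_reduce_eq (congrArg reduce hu)
  mul_prefix k hk := by
    obtain ⟨u, -, hu⟩ := thinWords_mul _ h k hk
    exact mul_prefix_of_reduce_eq hu

/-- A simple braid complementary to a thin one: it lacks only the first letter `i`, and only the
last letter `j`. -/
structure IsCothin (i j : Fin 3) (s : BraidGroup) : Prop where
  isThin : IsThin j i.rev (s⁻¹ * Δ)
  prefix_first : ∀ k ≠ i, Prefix (.of k) s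

theorem IsCothin.mul_prefix {i j : Fin 3} {s : BraidGroup} (h : IsCothin i j s) :
    Prefix (s * .of j) Δ := by
  have := h.isThin.prefix_first
  rwa [Prefix, ← mul_assoc, ← mul_inv_rev] at this

/-- The simple braid `σ₁ σ₃ σ₂`. -/
def mixedBraid : BraidGroup := braid [0, 2, 1]

theorem simpleWords_cases : ∀ v ∈ simpleWords,
    v = [] ∨ reduce v = reduce halfTwist ∨ reduce v = reduce [1, 0, 2] ∨
      reduce v = reduce [0, 2, 1] ∨ (∃ e ∈ thinWords, reduce v = reduce e.1) ∨
      ∃ e ∈ thinWords, reduce (v ++ e.1) = reduce halfTwist ∧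
        ∀ k ≠ e.2.2.rev, ∃ u ∈ simpleWords, reduce v = reduce (k :: u) := by
  decide +kernel

theorem IsSimple.cases {s : BraidGroup} (hs : IsSimple s) :
    s = 1 ∨ s = Δ ∨ s = σ₂ * σ₁ * σ₃ ∨ s = mixedBraid ∨
      (∃ i j, IsThin i j s) ∨ ∃ i j, IsCothin i j s := by
  obtain ⟨v, hv, rfl⟩ := hs.exists_mem_simpleWords
  rcases simpleWords_cases v hv with
    rfl | h | h | h | ⟨⟨w, i, j⟩, he, h⟩ | ⟨⟨w, i, j⟩, he, h, hk⟩
  · exact .inl rfl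
  · exact .inr <| .inl <| by rw [braid_eq_of_reduce_eq h, braid_halfTwist]
  · exact .inr <| .inr <| .inl <| by
      rw [braid_eq_of_reduce_eq h]; simp [braid, σ₁, σ₂, σ₃, mul_assoc]
  · exact .inr <| .inr <| .inr <| .inl <| braid_eq_of_reduce_eq h
  · refine .inr <| .inr <| .inr <| .inr <| .inl ⟨i, j, ?_⟩
    rw [braid_eq_of_reduce_eq h]
    exact isThin_braid he
  · refine .inr <| .inr <| .inr <| .inr <| .inr ⟨j.rev, i, ?_, fun k hk' => ?_⟩
    · rw [← braid_halfTwist, ← braid_eq_of_reduce_eq h, braid_append, inv_mul_cancel_left,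
        Fin.rev_rev]
      exact isThin_braid he
    · obtain ⟨u, -, hu⟩ := hk k hk'
      exact prefix_of_reduce_eq hu

theorem mixedBraid_prefix {k : Fin 3} (hk : k ≠ 1) : Prefix (.of k) mixedBraid := by
  have : ∀ k : Fin 3, k ≠ 1 → ∃ u ∈ simpleWords, reduce [0, 2, 1] = reduce (k :: u) := by
    decide +kernel
  obtain ⟨u, -, hu⟩ := this k hk
  exact prefix_of_reduce_eq hu

theorem mixedBraid_mul_prefix {k : Fin 3} (hk : k ≠ 1) : Prefix (mixedBraid * .of k) Δ := by
  have : ∀ k : Fin 3, k ≠ 1 →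
      ∃ u ∈ simpleWords, reduce ([0, 2, 1] ++ k :: u) = reduce halfTwist := by
    decide +kernel
  obtain ⟨u, -, hu⟩ := this k hk
  exact mul_prefix_of_reduce_eq hu

theorem prefix_Δ (k : Fin 3) : Prefix (.of k) Δ := by
  have : ∀ k : Fin 3, ∃ u ∈ simpleWords, reduce halfTwist = reduce (k :: u) := by
    decide +kernel
  obtain ⟨u, -, hu⟩ := this k
  rw [← braid_halfTwist]
  exact prefix_of_reduce_eq hu

/-! ### Left-weighted pairs -/

/-- Otherwise `s σₖ` would be a common prefix of `Δ` and `s s'`, hence a prefix of their gcd `s`,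
making `σₖ⁻¹` positive. -/
theorem LeftWeighted.not_mul_prefix {s s' : BraidGroup} (h : LeftWeighted s s') {k : Fin 3}
    (hk : Prefix (.of k) s') : ¬ Prefix (s * .of k) Δ := by
  intro hs
  have := h.2.2 (s * .of k) hs (by simpa [Prefix, mul_assoc] using hk)
  rw [Prefix, mul_inv_rev, mul_assoc, inv_mul_cancel, mul_one] at this
  exact inv_of_notMem_positiveMonoid k this

theorem IsSimple.exists_prefix {s : BraidGroup} (hs : IsSimple s) (h1 : s ≠ 1) :
    ∃ k : Fin 3, Prefix (.of k) s := by
  obtain ⟨v, -, rfl⟩ := hs.exists_mem_simpleWords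
  cases v with
  | nil => exact absurd rfl h1
  | cons k v => exact ⟨k, prefix_of_reduce_eq rfl⟩

theorem one_notMem_of_isChain {L : List BraidGroup} (hs : ∀ s ∈ L, IsSimple s)
    (hlast : L.getLast? ≠ some 1) (hw : L.IsChain LeftWeighted) : 1 ∉ L := by
  induction L with
  | nil => simp
  | cons s L ih =>
    cases L with
    | nil => simpa [eq_comm] using hlast
    | cons s' L =>
      rw [List.isChain_cons_cons] at hw
      have h := ih (fun t ht => hs t (List.mem_cons_of_mem _ ht)) (by simpa using hlast) hw.2
      rw [List.mem_cons, not_or]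
      refine ⟨?_, h⟩
      rintro rfl
      obtain ⟨k, hk⟩ := (hs s' (by simp)).exists_prefix (by rintro rfl; simp at h)
      -- The pair `(1, s')` is not left-weighted: a first letter of `s'` already divides `Δ`.
      exact hw.1.not_mul_prefix hk (by simpa using prefix_Δ k)

/-! ### Leading matrices -/

open Polynomial (X toLaurent)

/-- The substitution `q ↦ y⁻²`. -/
noncomputable def substitution : ℤ[T;T⁻¹] →+* ℤ[T;T⁻¹] :=
  AddMonoidAlgebra.mapDomainRingHom ℤ (AddMonoidHom.mulLeft (-2 : ℤ))

theorem substitution_q : substitution q = LaurentPolynomial.T (-2) := by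
  rw [q, LaurentPolynomial.T, LaurentPolynomial.T, substitution]
  simp only [AddMonoidAlgebra.mapDomainRingHom_apply, AddMonoidAlgebra.mapDomain_single]
  rfl

/-- Substitute `q = y⁻²` and conjugate by `diag(1, y⁻¹, y⁻²)`. -/
noncomputable def rescale :
    Matrix (Fin 3) (Fin 3) ℤ[T;T⁻¹] →* Matrix (Fin 3) (Fin 3) ℤ[T;T⁻¹] where
  toFun M := .of fun a b => substitution (M a b) * LaurentPolynomial.T ((b : ℕ) - (a : ℕ) : ℤ)
  map_one' := by
    ext a b : 1
    rcases eq_or_ne a b with rfl | h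
    · simp
    · simp [h]
  map_mul' M N := by
    ext a b : 1
    simp only [Matrix.of_apply, Matrix.mul_apply, map_sum, map_mul, Finset.sum_mul]
    refine Finset.sum_congr rfl fun c _ => ?_
    have e : ((b : ℕ) - (a : ℕ) : ℤ) = ((c : ℕ) - (a : ℕ)) + ((b : ℕ) - (c : ℕ)) := by ring
    rw [e, LaurentPolynomial.T_add]
    ring

/-- The rescaled matrix of `M` is `y ^ k` times a matrix of polynomials in `y` with constant
term `A`. -/
def HasLead (M : Matrix (Fin 3) (Fin 3) ℤ[T;T⁻¹]) (k : ℤ) (A : Matrix (Fin 3) (Fin 3) ℤ) : Prop :=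
  ∃ Q : Matrix (Fin 3) (Fin 3) (Polynomial ℤ),
    rescale M = (LaurentPolynomial.T k : ℤ[T;T⁻¹]) • Q.map toLaurent ∧
      Q.map Polynomial.constantCoeff = A

theorem hasLead_one : HasLead 1 0 1 :=
  ⟨1, by simp, by simp⟩

/-- The product `A * B` may vanish; keeping it nonzero is the role of the peak rows. -/
theorem HasLead.mul {M N : Matrix (Fin 3) (Fin 3) ℤ[T;T⁻¹]} {k l : ℤ}
    {A B : Matrix (Fin 3) (Fin 3) ℤ} (hM : HasLead M k A) (hN : HasLead N l B) :
    HasLead (M * N) (k + l) (A * B) := by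
  obtain ⟨P, hP, rfl⟩ := hM
  obtain ⟨Q, hQ, rfl⟩ := hN
  refine ⟨P * Q, ?_, Matrix.map_mul⟩
  rw [map_mul, hP, hQ, Matrix.map_mul, Matrix.smul_mul, Matrix.mul_smul, smul_smul,
    LaurentPolynomial.T_add]

theorem HasLead.le {M : Matrix (Fin 3) (Fin 3) ℤ[T;T⁻¹]} {k l : ℤ}
    {A B : Matrix (Fin 3) (Fin 3) ℤ} (hA : HasLead M k A) (hB : HasLead M l B) (h0 : A ≠ 0) :
    l ≤ k := by
  obtain ⟨P, hP, rfl⟩ := hA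
  obtain ⟨Q, hQ, rfl⟩ := hB
  by_contra! hlt
  -- Here `n + 1 = l - k`, so `P` is a positive power of `y` times `Q` and has zero constant term.
  obtain ⟨n, hn⟩ := Int.eq_ofNat_of_zero_le (show 0 ≤ l - k - 1 by omega)
  apply h0
  ext a b
  have h := congrFun (congrFun (hP.symm.trans hQ) a) b
  simp only [Matrix.smul_apply, Matrix.map_apply, smul_eq_mul] at h
  have h' : toLaurent (P a b) = toLaurent (X ^ (n + 1) * Q a b) := by
    rw [map_mul, Polynomial.toLaurent_X_pow]
    have := congrArg (LaurentPolynomial.T (-k) * ·) h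
    simp only [← mul_assoc, ← LaurentPolynomial.T_add] at this
    rw [neg_add_cancel, LaurentPolynomial.T_zero, one_mul] at this
    rw [this]
    congr 2
    push_cast
    omega
  rw [Matrix.map_apply, Polynomial.toLaurent_injective h']
  simp [pow_succ]

theorem HasLead.unique {M : Matrix (Fin 3) (Fin 3) ℤ[T;T⁻¹]} {k l : ℤ}
    {A B : Matrix (Fin 3) (Fin 3) ℤ} (hA : HasLead M k A) (hB : HasLead M l B) (hA0 : A ≠ 0)
    (hB0 : B ≠ 0) : k = l ∧ A = B := by
  obtain rfl := le_antisymm (hB.le hA hB0) (hA.le hB hA0)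
  refine ⟨rfl, ?_⟩
  obtain ⟨P, hP, rfl⟩ := hA
  obtain ⟨Q, hQ, rfl⟩ := hB
  have h := congrArg (fun M => (LaurentPolynomial.T (-k) : ℤ[T;T⁻¹]) • M) (hP.symm.trans hQ)
  simp only [smul_smul, ← LaurentPolynomial.T_add, neg_add_cancel, LaurentPolynomial.T_zero,
    one_smul] at h
  rw [Matrix.map_injective Polynomial.toLaurent_injective h]

/-! ### Leading matrices of simple braids -/

/-- The rescaled Burau matrix of a generator, multiplied by `y ^ 2`. -/
noncomputable def scaledGenerator : Fin 3 → Matrix (Fin 3) (Fin 3) (Polynomial ℤ) :=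
  ![!![-1, 0, 0; X, X ^ 2, 0; 0, 0, X ^ 2],
    !![X ^ 2, X, 0; 0, -1, 0; 0, X, X ^ 2],
    !![X ^ 2, 0, 0; 0, X ^ 2, X; 0, 0, -1]]

theorem rescale_burau (i : Fin 3) :
    rescale (ρ₄ (PresentedGroup.of i)).val =
      (LaurentPolynomial.T (-2) : ℤ[T;T⁻¹]) • (scaledGenerator i).map toLaurent := by
  rw [ρ₄, PresentedGroup.toGroup.of]
  fin_cases i <;> ext a b : 1 <;> fin_cases a <;> fin_cases b <;>
    simp [rescale, burau₁, burau₂, burau₃, scaledGenerator, substitution_q,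
      -LaurentPolynomial.T_mul, ← LaurentPolynomial.T_add]

theorem rescale_braid (w : List (Fin 3)) :
    rescale (ρ₄ (braid w)).val = (LaurentPolynomial.T (-2 * w.length) : ℤ[T;T⁻¹]) •
      (w.map scaledGenerator).prod.map toLaurent := by
  induction w with
  | nil => simp
  | cons i w ih =>
    rw [braid_cons, map_mul, Units.val_mul, map_mul, ih, rescale_burau, List.map_cons,
      List.prod_cons, Matrix.map_mul, Matrix.smul_mul, Matrix.mul_smul, smul_smul,
      ← LaurentPolynomial.T_add]
    congr 2
    push_cast [List.length_cons]
    ring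

theorem hasLead_braid {w : List (Fin 3)} {m : ℕ} {Q : Matrix (Fin 3) (Fin 3) (Polynomial ℤ)}
    (h : (w.map scaledGenerator).prod = (X ^ m : Polynomial ℤ) • Q) :
    HasLead (ρ₄ (braid w)).val (m - 2 * w.length) (Q.map Polynomial.constantCoeff) := by
  refine ⟨Q, ?_, rfl⟩
  rw [rescale_braid, h]
  ext a b : 1
  simp only [Matrix.smul_apply, Matrix.map_apply, smul_eq_mul, map_mul,
    Polynomial.toLaurent_X_pow, ← mul_assoc, ← LaurentPolynomial.T_add]
  congr 2
  ring

theorem exists_scaledGenerator_prod_eq : ∀ e ∈ thinWords,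
    ∃ (m : ℕ) (Q : Matrix (Fin 3) (Fin 3) (Polynomial ℤ)),
      (e.1.map scaledGenerator).prod = (X ^ m : Polynomial ℤ) • Q ∧
        Q.map Polynomial.constantCoeff = Matrix.single e.2.1 e.2.2 (-1) := by
  -- Each entry records the power of `y` dividing the word's product and the quotient matrix.
  have key : ∀ e ∈ [
      (([0], 0, 0), 0, !![-1, 0, 0; X, X ^ 2, 0; 0, 0, X ^ 2]),
      (([0, 1], 0, 1), 1, !![-X, -1, 0; X ^ 2, 0, 0; 0, X ^ 2, X ^ 3]),
      (([0, 1, 2], 0, 2), 2, !![-X ^ 2, -X, -1; X ^ 3, 0, 0; 0, X ^ 3, 0]),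
      (([1, 0], 1, 0), 1, !![0, X ^ 2, 0; -1, -X, 0; X, X ^ 2, X ^ 3]),
      (([1], 1, 1), 0, !![X ^ 2, X, 0; 0, -1, 0; 0, X, X ^ 2]),
      (([1, 0, 2, 1], 1, 1), 4, !![0, 0, X ^ 2; -X, -1, -X; X ^ 2, 0, 0]),
      (([1, 2], 1, 2), 1, !![X ^ 3, X ^ 2, X; 0, -X, -1; 0, X ^ 2, 0]),
      (([2, 1, 0], 2, 0), 2, !![0, X ^ 3, 0; 0, 0, X ^ 3; -1, -X, -X ^ 2]),
      (([2, 1], 2, 1), 1, !![X ^ 3, X ^ 2, 0; 0, 0, X ^ 2; 0, -1, -X]),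
      ((([2], 2, 2) : List (Fin 3) × Fin 3 × Fin 3), (0 : ℕ),
        (!![X ^ 2, 0, 0; 0, X ^ 2, X; 0, 0, -1] : Matrix (Fin 3) (Fin 3) (Polynomial ℤ)))],
      (e.1.1.map scaledGenerator).prod = (X ^ e.2.1 : Polynomial ℤ) • e.2.2 ∧
        e.2.2.map Polynomial.constantCoeff = Matrix.single e.1.2.1 e.1.2.2 (-1) := by
    simp only [List.forall_mem_cons, List.not_mem_nil, false_imp_iff, implies_true, and_true]
    refine ⟨?_, ?_, ?_, ?_, ?_, ?_, ?_, ?_, ?_, ?_⟩ <;> constructor <;> ext a b : 1 <;>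
      fin_cases a <;> fin_cases b <;>
      simp [scaledGenerator, Matrix.mul_apply, Fin.sum_univ_three, Matrix.single] <;> ring
  simp only [List.forall_mem_cons, List.not_mem_nil, false_imp_iff, implies_true, and_true] at key
  obtain ⟨h1, h2, h3, h4, h5, h6, h7, h8, h9, h10⟩ := key
  simp only [thinWords, List.forall_mem_cons, List.not_mem_nil, false_imp_iff, implies_true,
    and_true]
  exact ⟨⟨_, _, h1⟩, ⟨_, _, h2⟩, ⟨_, _, h3⟩, ⟨_, _, h4⟩, ⟨_, _, h5⟩, ⟨_, _, h6⟩, ⟨_, _, h7⟩,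
    ⟨_, _, h8⟩, ⟨_, _, h9⟩, ⟨_, _, h10⟩⟩

theorem IsThin.hasLead {i j : Fin 3} {s : BraidGroup} (hs : IsThin i j s) :
    ∃ k, HasLead (ρ₄ s).val k (Matrix.single i j (-1)) := by
  obtain ⟨w, hw, rfl⟩ := hs.mem
  obtain ⟨m, Q, hQ, hA⟩ := exists_scaledGenerator_prod_eq _ hw
  exact ⟨_, hA ▸ hasLead_braid hQ⟩

theorem hasLead_mixedBraid :
    ∃ k, HasLead (ρ₄ mixedBraid).val k !![0, -1, 0; 0, 0, 0; 0, -1, 0] := by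
  have h : (([0, 2, 1] : List (Fin 3)).map scaledGenerator).prod = (X ^ 3 : Polynomial ℤ) •
      !![-X, -1, 0; X ^ 2, X, X ^ 2; 0, -1, -X] := by
    ext a b : 1
    fin_cases a <;> fin_cases b <;>
      simp [scaledGenerator, Matrix.mul_apply, Fin.sum_univ_three] <;> ring
  have e : (!![-X, -1, 0; X ^ 2, X, X ^ 2; 0, -1, -X] :
      Matrix (Fin 3) (Fin 3) (Polynomial ℤ)).map Polynomial.constantCoeff =
        !![0, -1, 0; 0, 0, 0; 0, -1, 0] := by
    ext a b : 1
    fin_cases a <;> fin_cases b <;> simp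
  exact ⟨_, e ▸ hasLead_braid h⟩

/-- The leading matrix of the half twist. -/
def antidiagonal : Matrix (Fin 3) (Fin 3) ℤ := !![0, 0, -1; 0, -1, 0; -1, 0, 0]

theorem antidiagonal_mul_self : antidiagonal * antidiagonal = 1 := by decide

/-- The reversal in `IsCothin` comes from conjugation by `Δ`, which exchanges `σ₁` and `σ₃`;
multiplying by the lead of `Δ⁻¹` undoes it. -/
theorem single_rev_mul_antidiagonal (i j : Fin 3) :
    Matrix.single j i.rev (-1) * antidiagonal = Matrix.single j i 1 := by
  revert i j
  decide

theorem rescale_Δ : rescale (ρ₄ Δ).val =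
    (LaurentPolynomial.T (-4) : ℤ[T;T⁻¹]) • (antidiagonal.map Polynomial.C).map toLaurent := by
  have h : (halfTwist.map scaledGenerator).prod =
      (X ^ 8 : Polynomial ℤ) • antidiagonal.map Polynomial.C := by
    simp only [halfTwist, List.map_cons, List.map_nil, List.prod_cons, List.prod_nil, mul_one]
    ext a b : 1
    fin_cases a <;> fin_cases b <;>
      simp [scaledGenerator, Matrix.mul_apply, Fin.sum_univ_three, antidiagonal] <;> ring
  rw [← braid_halfTwist, rescale_braid, h]
  ext a b : 1
  simp only [Matrix.smul_apply, Matrix.map_apply, smul_eq_mul, map_mul,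
    Polynomial.toLaurent_X_pow, ← mul_assoc, ← LaurentPolynomial.T_add]
  rfl

theorem antidiagonal_map_C : (antidiagonal.map Polynomial.C).map Polynomial.constantCoeff =
    antidiagonal := by
  ext a b : 1
  simp

theorem hasLead_Δ : HasLead (ρ₄ Δ).val (-4) antidiagonal :=
  ⟨_, rescale_Δ, antidiagonal_map_C⟩

theorem hasLead_Δ_inv : HasLead (ρ₄ Δ⁻¹).val 4 antidiagonal := by
  refine ⟨_, ?_, antidiagonal_map_C⟩
  have h1 : rescale (ρ₄ Δ⁻¹).val * rescale (ρ₄ Δ).val = 1 := by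
    rw [← map_mul, ← Units.val_mul, ← map_mul, inv_mul_cancel, map_one, Units.val_one, map_one]
  refine left_inv_eq_right_inv h1 ?_
  rw [rescale_Δ, Matrix.smul_mul, Matrix.mul_smul, smul_smul, ← LaurentPolynomial.T_add,
    ← Matrix.map_mul, ← Matrix.map_mul, antidiagonal_mul_self]
  simp

theorem hasLead_Δ_zpow (n : ℤ) :
    ∃ A : Matrix (Fin 3) (Fin 3) ℤ, A * A = 1 ∧ HasLead (ρ₄ (Δ ^ n)).val (-4 * n) A := by
  have key {g : BraidGroup} {k : ℤ} (hg : HasLead (ρ₄ g).val k antidiagonal) (m : ℕ) :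
      ∃ A : Matrix (Fin 3) (Fin 3) ℤ, A * A = 1 ∧ Commute A antidiagonal ∧
        HasLead (ρ₄ (g ^ m)).val (k * m) A := by
    induction m with
    | zero => exact ⟨1, by simp, .one_left _, by simpa using hasLead_one⟩
    | succ m ih =>
      obtain ⟨A, hA, hc, h⟩ := ih
      refine ⟨A * antidiagonal, ?_, hc.mul_left (.refl _), ?_⟩
      · rw [hc.symm.mul_mul_mul_comm, hA, antidiagonal_mul_self, one_mul]
      · rw [pow_succ, map_mul, Units.val_mul]
        convert h.mul hg using 1
        push_cast
        ring
  obtain ⟨m, rfl | rfl⟩ := n.eq_nat_or_neg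
  · obtain ⟨A, hA, -, h⟩ := key hasLead_Δ m
    exact ⟨A, hA, by simpa using h⟩
  · obtain ⟨A, hA, -, h⟩ := key hasLead_Δ_inv m
    exact ⟨A, hA, by simpa using h⟩

/-! ### Peak rows -/

/-- The rows of `M` attaining the largest rescaled degree are those with index in `S`. -/
def HasPeak (M : Matrix (Fin 3) (Fin 3) ℤ[T;T⁻¹]) (S : Set (Fin 3)) : Prop :=
  ∃ k A, HasLead M k A ∧ ∀ a, A a ≠ 0 ↔ a ∈ S

theorem HasPeak.unique {M : Matrix (Fin 3) (Fin 3) ℤ[T;T⁻¹]} {S S' : Set (Fin 3)}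
    (h : HasPeak M S) (h' : HasPeak M S') (hS : S.Nonempty) (hS' : S'.Nonempty) : S = S' := by
  obtain ⟨k, A, hA, hAS⟩ := h
  obtain ⟨l, B, hB, hBS⟩ := h'
  obtain ⟨a, ha⟩ := hS
  obtain ⟨b, hb⟩ := hS'
  obtain ⟨-, rfl⟩ := hA.unique hB (fun h0 => (hAS a).2 ha (congrFun h0 a))
    (fun h0 => (hBS b).2 hb (congrFun h0 b))
  exact Set.ext fun c => (hAS c).symm.trans (hBS c)

theorem hasPeak_Δ_zpow (n : ℤ) : HasPeak (ρ₄ (Δ ^ n)).val .univ := by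
  obtain ⟨A, hA, h⟩ := hasLead_Δ_zpow n
  refine ⟨_, A, h, fun a => iff_of_true (fun h0 => ?_) (Set.mem_univ a)⟩
  -- A zero row of `A` would put a zero on the diagonal of `A * A = 1`.
  have := congrFun (congrFun hA a) a
  simp [Matrix.mul_apply, h0] at this

theorem hasPeak_one : HasPeak 1 .univ := by
  simpa using hasPeak_Δ_zpow 0

/-- A multiple of `E i j` copies row `j` of the other lead, nonzero since `j ∈ S`, into row `i` and
kills the rest. -/
theorem HasLead.hasPeak_mul {M N : Matrix (Fin 3) (Fin 3) ℤ[T;T⁻¹]} {k : ℤ} {i j : Fin 3} {c : ℤ}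
    {S : Set (Fin 3)} (hM : HasLead M k (Matrix.single i j c)) (hc : c ≠ 0) (hN : HasPeak N S)
    (hj : j ∈ S) : HasPeak (M * N) {i} := by
  obtain ⟨l, A, hA, hAS⟩ := hN
  refine ⟨_, _, hM.mul hA, fun a => ?_⟩
  rw [Set.mem_singleton_iff]
  constructor
  · contrapose!
    intro ha
    ext b
    simp [ha]
  · rintro rfl h0
    refine (hAS j).2 hj (funext fun b => ?_)
    simpa [hc] using congrFun h0 b

/-- Only column `1` of this lead is nonzero, so rows `0` and `2` are both minus row `1` of the lead
of `N`, and nothing cancels. -/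
theorem hasPeak_mixedBraid_mul {N : Matrix (Fin 3) (Fin 3) ℤ[T;T⁻¹]}
    {S : Set (Fin 3)} (hN : HasPeak N S) (h1 : 1 ∈ S) :
    HasPeak ((ρ₄ mixedBraid).val * N) {0, 2} := by
  obtain ⟨k, hM⟩ := hasLead_mixedBraid
  obtain ⟨l, A, hA, hAS⟩ := hN
  have h := (hAS 1).2 h1
  have e : (!![0, -1, 0; 0, 0, 0; 0, -1, 0] * A : Matrix (Fin 3) (Fin 3) ℤ) =
      ![-A 1, 0, -A 1] := by
    ext a b
    fin_cases a <;> simp [Matrix.mul_apply, Fin.sum_univ_three]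
  refine ⟨_, _, hM.mul hA, fun a => ?_⟩
  rw [e]
  fin_cases a <;> simp [h]

theorem IsThin.hasPeak_mul {i j : Fin 3} {s : BraidGroup} (hs : IsThin i j s) {g : BraidGroup}
    {S : Set (Fin 3)} (hg : HasPeak (ρ₄ g).val S) (hj : j ∈ S) :
    HasPeak (ρ₄ (s * g)).val {i} := by
  obtain ⟨k, hk⟩ := hs.hasLead
  rw [map_mul, Units.val_mul]
  exact hk.hasPeak_mul (by simp) hg hj

theorem IsCothin.hasPeak_inv_mul {i j : Fin 3} {s : BraidGroup} (hs : IsCothin i j s)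
    {g : BraidGroup} {S : Set (Fin 3)} (hg : HasPeak (ρ₄ g).val S) (hi : i ∈ S) :
    HasPeak (ρ₄ (s⁻¹ * g)).val {j} := by
  obtain ⟨k, hk⟩ := hs.isThin.hasLead
  have h := hk.mul hasLead_Δ_inv
  rw [← Units.val_mul, ← map_mul, mul_inv_cancel_right] at h
  rw [map_mul, Units.val_mul]
  rw [single_rev_mul_antidiagonal] at h
  exact h.hasPeak_mul one_ne_zero hg hi

/-! ### Normal forms -/

/-- A simple braid other than `1` and `σ₂ σ₁ σ₃` that can occur in a normal form. -/
def IsFactor (s : BraidGroup) : Prop := IsSimple s ∧ s ≠ 1 ∧ s ≠ σ₂ * σ₁ * σ₃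

theorem exists_ne_ne (i j : Fin 3) : ∃ k, k ≠ i ∧ k ≠ j := by
  revert i j; decide

/-- A normal form factor whose only first letter is `j` is thin. -/
theorem IsFactor.isThin_of_mul_prefix {s' : BraidGroup} (hs' : IsFactor s') {j : Fin 3}
    (h : ∀ k, Prefix (.of k) s' → k = j) : ∃ l, IsThin j l s' := by
  obtain ⟨hs, h1, h213⟩ := hs'
  rcases hs.cases with rfl | rfl | rfl | rfl | ⟨i, l, hl⟩ | ⟨i, l, hl⟩
  · exact absurd rfl h1
  · exact absurd ((h 0 (prefix_Δ 0)).trans (h 1 (prefix_Δ 1)).symm) (by decide)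
  · exact absurd rfl h213
  · exact absurd ((h 0 (mixedBraid_prefix (by decide))).trans
      (h 2 (mixedBraid_prefix (by decide))).symm) (by decide)
  · exact ⟨l, h i hl.prefix_first ▸ hl⟩
  · obtain ⟨k, hki, hkj⟩ := exists_ne_ne i j
    exact absurd (h k (hl.prefix_first k hki)) hkj

theorem IsThin.hasPeak_prod {i j : Fin 3} {s : BraidGroup} (hs : IsThin i j s)
    {L : List BraidGroup} (hL : ∀ t ∈ L, IsFactor t) (hw : (s :: L).IsChain LeftWeighted) :
    HasPeak (ρ₄ (s :: L).prod).val {i} := by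
  rw [List.prod_cons]
  induction L generalizing s i j with
  | nil => exact hs.hasPeak_mul (S := .univ) (by simpa using hasPeak_one) (Set.mem_univ j)
  | cons t L ih =>
    rw [List.isChain_cons_cons] at hw
    obtain ⟨l, ht⟩ := (hL t (by simp)).isThin_of_mul_prefix (j := j) fun k hk => by
      by_contra hkj
      exact hw.1.not_mul_prefix hk (hs.mul_prefix k hkj)
    refine hs.hasPeak_mul ?_ (Set.mem_singleton j)
    rw [List.prod_cons]
    exact ih ht (fun u hu => hL u (by simp [hu])) hw.2

theorem hasPeak_mixedBraid_prod {L : List BraidGroup} (hL : ∀ t ∈ L, IsFactor t)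
    (hw : (mixedBraid :: L).IsChain LeftWeighted) :
    HasPeak (ρ₄ (mixedBraid :: L).prod).val {0, 2} := by
  rw [List.prod_cons, map_mul, Units.val_mul]
  cases L with
  | nil => exact hasPeak_mixedBraid_mul (S := .univ) (by simpa using hasPeak_one) (Set.mem_univ 1)
  | cons t L =>
    rw [List.isChain_cons_cons] at hw
    obtain ⟨l, ht⟩ := (hL t (by simp)).isThin_of_mul_prefix (j := 1) fun k hk => by
      by_contra hk1
      exact hw.1.not_mul_prefix hk (mixedBraid_mul_prefix hk1)
    exact hasPeak_mixedBraid_mul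
      (ht.hasPeak_prod (fun u hu => hL u (by simp [hu])) hw.2) (Set.mem_singleton 1)

/-- Induction stripping cothin heads: the pair of conditions on `g` and on the head of `L` is
restored with `j` replaced by the letter that the stripped factor lacks at its end. -/
theorem ρ₄_prod_ne {L : List BraidGroup} (hL : ∀ t ∈ L, IsFactor t)
    (hw : L.IsChain LeftWeighted) {g : BraidGroup} {j : Fin 3} (hg : HasPeak (ρ₄ g).val {j})
    (hhead : ∀ s ∈ L.head?, ¬ Prefix (.of j) s) : ρ₄ L.prod ≠ ρ₄ g := by
  intro heq
  induction L generalizing g j with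
  | nil =>
    rw [← heq] at hg
    have := hg.unique (by simpa using hasPeak_one) (Set.singleton_nonempty j) Set.univ_nonempty
    obtain ⟨k, hk, -⟩ := exists_ne_ne j j
    exact hk (this.symm.subset (Set.mem_univ k))
  | cons s L ih =>
    have hs := hL s (by simp)
    have hL' : ∀ t ∈ L, IsFactor t := fun t ht => hL t (by simp [ht])
    have hj : ¬ Prefix (.of j) s := hhead s (by simp)
    rcases hs.1.cases with h | rfl | h | rfl | ⟨i, l, hl⟩ | ⟨i, l, hl⟩
    · exact hs.2.1 h
    · exact hj (prefix_Δ j)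
    · exact hs.2.2 h
    · have := (heq ▸ hg).unique (hasPeak_mixedBraid_prod hL' hw) (Set.singleton_nonempty j)
        ⟨0, by simp⟩
      exact absurd ((this.symm.subset (by simp : (0 : Fin 3) ∈ _)).trans
        (this.symm.subset (by simp : (2 : Fin 3) ∈ _)).symm) (by decide)
    · have := (heq ▸ hg).unique (hl.hasPeak_prod hL' hw) (Set.singleton_nonempty j)
        (Set.singleton_nonempty i)
      obtain rfl := Set.singleton_injective this
      exact hj hl.prefix_first
    -- A cothin head begins with every letter but `i`, so the letter it avoids is `i`.
    · obtain rfl : j = i := by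
        by_contra hji
        exact hj (hl.prefix_first j hji)
      refine ih hL' hw.of_cons (hl.hasPeak_inv_mul hg rfl) ?_ ?_
      · intro t ht hlt
        cases L with
        | nil => simp at ht
        | cons t' L =>
          obtain rfl : t' = t := by simpa using ht
          exact (List.isChain_cons_cons.1 hw).1.not_mul_prefix hlt hl.mul_prefix
      · rw [map_mul, ← heq, ← map_mul, List.prod_cons, inv_mul_cancel_left]

theorem ρ₄_prod_ne_Δ_zpow {L : List BraidGroup} (hL : ∀ t ∈ L, IsFactor t)
    (hw : L.IsChain LeftWeighted) (hnil : L ≠ []) (hhead : L.head? ≠ some Δ) (n : ℤ) :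
    ρ₄ L.prod ≠ ρ₄ (Δ ^ n) := by
  intro heq
  have hg := hasPeak_Δ_zpow n
  cases L with
  | nil => exact hnil rfl
  | cons s L =>
    have hs := hL s (by simp)
    have hL' : ∀ t ∈ L, IsFactor t := fun t ht => hL t (by simp [ht])
    rcases hs.1.cases with h | rfl | h | rfl | ⟨i, l, hl⟩ | ⟨i, l, hl⟩
    · exact hs.2.1 h
    · exact hhead rfl
    · exact hs.2.2 h
    · have := (heq ▸ hg).unique (hasPeak_mixedBraid_prod hL' hw) Set.univ_nonempty ⟨0, by simp⟩
      simpa using this.subset (Set.mem_univ 1)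
    · have := (heq ▸ hg).unique (hl.hasPeak_prod hL' hw) Set.univ_nonempty
        (Set.singleton_nonempty i)
      obtain ⟨k, hk, -⟩ := exists_ne_ne i i
      exact hk (this.subset (Set.mem_univ k))
    · refine ρ₄_prod_ne hL' hw.of_cons (hl.hasPeak_inv_mul hg (Set.mem_univ i)) ?_ ?_
      · intro t ht hlt
        cases L with
        | nil => simp at ht
        | cons t' L =>
          obtain rfl : t' = t := by simpa using ht
          exact (List.isChain_cons_cons.1 hw).1.not_mul_prefix hlt hl.mul_prefix
      · rw [map_mul, ← heq, ← map_mul, List.prod_cons, inv_mul_cancel_left]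

theorem ρ₄_Δ_zpow_ne_one {n : ℤ} (hn : n ≠ 0) : ρ₄ (Δ ^ n) ≠ 1 := by
  intro h
  obtain ⟨A, hA, hl⟩ := hasLead_Δ_zpow n
  rw [h, Units.val_one] at hl
  -- Comparing leading orders gives `-4 * n = 0`.
  have := (hl.unique hasLead_one (by rintro rfl; simp at hA) one_ne_zero).1
  omega

end FourBraid

theorem theorem3p2 (x : FourBraid.BraidGroup) (hx : x ≠ 1)
    (p : ℤ) (L : List FourBraid.BraidGroup)
    (hL : FourBraid.IsLeftNormalForm x p L)
    (hfactor : FourBraid.σ₂ * FourBraid.σ₁ * FourBraid.σ₃ ∉ L) :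
    FourBraid.ρ₄ x ≠ 1 := by
  have h1 := FourBraid.one_notMem_of_isChain hL.simple hL.last_ne hL.weighted
  intro hρ
  rcases eq_or_ne L [] with rfl | hnil
  · obtain rfl : x = FourBraid.Δ ^ p := by simpa using hL.eq_prod
    refine FourBraid.ρ₄_Δ_zpow_ne_one ?_ hρ
    rintro rfl
    exact hx (zpow_zero _)
  · refine FourBraid.ρ₄_prod_ne_Δ_zpow (L := L) (fun t ht => ⟨hL.simple t ht, ?_, ?_⟩)
      hL.weighted hnil hL.head_ne (-p) ?_
    · rintro rfl
      exact h1 ht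
    · rintro rfl
      exact hfactor ht
    · rw [hL.eq_prod, map_mul, mul_eq_one_iff_inv_eq, ← map_inv, ← zpow_neg] at hρ
      exact hρ.symm
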